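/- Let $(E,\mathcal E)$ be a measurable space and let $\rho$ be a distortion measure on $E$, i.e. a measurable, symmetric function $\rho:E\times E\to[0,\infty)$ with $\rho(x,y)=0$ if and only if $x=y$ (no triangle inequality is assumed). Assume that $w:=\sup_{x,y\in E}\rho(x,y)<\infty$ and that the upper box dimension $$\gamma:=\limsup_{\varepsilon\downarrow 0}\frac{\log N(E,\rho,\varepsilon)}{\log(1/\varepsilon)}$$ is finite, where $N(E,\rho,\varepsilon):=\min\{n\in\mathbb N:\exists x_1,\dots,x_n\in E\ \forall x\in E\ \exists i:\ \rho(x,x_i)\le\varepsilon\}$ (and $N(E,\rho,\varepsilon)=\infty$ if there is no such $n$). Let $\mathbf D([0,1),E)$ be the space of piecewise constant functions $f:[0,1)\to E$ with finitely many jumps such that, if $f$ jumps at $t$ from $a$ to $b$, then $f(t)=b$; endow it with the $\sigma$-field induced by the projections and set $\rho_{\mathbf D}(f,g):=\int_0^1\rho(f(t),g(t))\,dt$. Let $X$ be a $\mathbf D([0,1),E)$-valued random variable, let $N_X$ be its number of jumps, and assume that for some constants $\lambda>0$ and $K\ge 1$ $$\mathbb P(N_X=k)\le \frac{\lambda^k}{k!}\,e^{-\lambda}K\qquad\text{for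 all integers } k\ge 0.$$ For $s>0$ and $r\ge 0$ define the quantization error $$D^{(q)}(r\,|\,X,\rho_{\mathbf D},s):=\inf\Big\{\Big(\mathbb E\min_{a\in\mathcal C}\rho_{\mathbf D}(X,a)^s\Big)^{1/s}:\ \emptyset\ne\mathcal C\subseteq\mathbf D([0,1),E)\text{ finite},\ \log\#\mathcal C\le r\Big\}.$$ Then for every $s>0$, as $r\to\infty$, $$-\log D^{(q)}(r\,|\,X,\rho_{\mathbf D},s)\ \gtrsim\ \sqrt{\frac{2}{s(1+\gamma)}\,r\log r},$$ where $f\gtrsim g$ means $\liminf_{r\to\infty} f(r)/g(r)\ge 1$ and $-\log 0:=+\infty$. -/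

import Mathlib

open MeasureTheory Filter Topology
open scoped ENNReal NNReal

namespace JumpCoding

/-- A distortion measure on a measurable space `E`: a (jointly) measurable, symmetric function
`ρ : E × E → [0, ∞)` with `ρ x y = 0` iff `x = y`. No triangle inequality is required. -/
structure IsDistortion {E : Type*} [MeasurableSpace E] (ρ : E → E → ℝ≥0) : Prop where
  measurable : Measurable (fun p : E × E => ρ p.1 p.2)
  symm : ∀ x y, ρ x y = ρ y x
  eq_zero_iff : ∀ x y, ρ x y = 0 ↔ x = y

/-- The half-open unit interval `[0, 1)`. -/
abbrev Time : Type := Set.Ico (0 : ℝ) 1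

/-- The space of functions `f : [0, 1) → E` that are piecewise constant with finitely many jumps,
where `f` takes at a jump position the value after the jump: there is a finite set `S` such that
`f t = f u` whenever `t ≤ u` and no point of `S` lies in `(t, u]`. -/
structure JumpPath (E : Type*) where
  toFun : Time → E
  piecewiseConst' : ∃ S : Finset Time, ∀ t u : Time, t ≤ u →
    (∀ v ∈ S, ¬ (t < v ∧ v ≤ u)) → toFun t = toFun u

instance {E : Type*} : CoeFun (JumpPath E) (fun _ => Time → E) := ⟨JumpPath.toFun⟩

/-- The σ-field on the path space that is induced by the projections `f ↦ f t`. -/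
instance {E : Type*} [MeasurableSpace E] : MeasurableSpace (JumpPath E) :=
  MeasurableSpace.comap (fun f : JumpPath E => (f : Time → E)) MeasurableSpace.pi

/-- The jump positions of a path: the points `t` such that `f` does not take the value `f t`
immediately to the left of `t`. (The point `0` never is one, since it has no left neighbours.) -/
def jumpSet {E : Type*} (f : JumpPath E) : Set Time :=
  {t | ¬ ∀ᶠ u in 𝓝[<] t, f u = f t}

theorem jumpSet_finite {E : Type*} (f : JumpPath E) : (jumpSet f).Finite := by
  obtain ⟨S, hS⟩ := f.piecewiseConst'
  refine S.finite_toSet.subset fun t ht => ?_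
  by_contra htS
  refine ht ?_
  have hfin : ({v : Time | v ∈ S ∧ v < t}).Finite := S.finite_toSet.subset fun v hv => hv.1
  have h1 : ∀ᶠ u in 𝓝[<] t, ∀ v ∈ {v : Time | v ∈ S ∧ v < t}, v < u := by
    rw [Filter.eventually_all_finite hfin]
    intro v hv
    exact eventually_nhdsWithin_of_eventually_nhds (eventually_gt_nhds hv.2)
  filter_upwards [h1, self_mem_nhdsWithin] with u hu hut
  refine hS u t (le_of_lt hut) fun v hv hvu => ?_
  rcases hvu.2.lt_or_eq with h | h
  · exact absurd (hu v ⟨hv, h⟩) (not_lt.mpr hvu.1.le)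
  · exact htS (h ▸ hv)

/-- The number of jumps of a path. -/
noncomputable def jumpCount {E : Type*} (f : JumpPath E) : ℕ := (jumpSet f).ncard

/-- The distortion `∫₀¹ ρ (f t) (g t) dt` on the path space. -/
noncomputable def pathDistortion {E : Type*} (ρ : E → E → ℝ≥0) (f g : JumpPath E) : ℝ≥0∞ :=
  ∫⁻ t : Time, (ρ (f t) (g t) : ℝ≥0∞) ∂(Measure.comap Subtype.val volume)

/-- The quantization error of the random element `X` under `P` at rate `r`, for the distortion `d`
and the moment `s`: the infimum of `(E min_{a ∈ C} d(X, a)^s)^{1/s}` over all codebooks `C` with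
`log #C ≤ r`. -/
noncomputable def quantError {Ω A : Type*} [MeasurableSpace Ω] (P : Measure Ω) (X : Ω → A)
    (d : A → A → ℝ≥0∞) (s r : ℝ) : ℝ≥0∞ :=
  ⨅ (C : Finset A) (_ : C.Nonempty) (_ : Real.log (C.card : ℝ) ≤ r),
    (∫⁻ ω, ⨅ a ∈ C, d (X ω) a ^ s ∂P) ^ (1 / s)

/-- The covering number `N(E, ρ, ε)` (`⊤` if there is no finite `ε`-net). -/
noncomputable def coveringNumber {E : Type*} (ρ : E → E → ℝ≥0) (ε : ℝ) : ℕ∞ :=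
  ⨅ (n : ℕ) (_ : ∃ x : Fin n → E, ∀ y : E, ∃ i, (ρ y (x i) : ℝ) ≤ ε), (n : ℕ∞)

/-- The upper box dimension `limsup_{ε → 0} log N(E, ρ, ε) / log (1 / ε)`, with values in the
extended reals. -/
noncomputable def upperBoxDim {E : Type*} (ρ : E → E → ℝ≥0) : EReal :=
  limsup (fun ε : ℝ => ENNReal.log ((coveringNumber ρ ε : ℕ∞) : ℝ≥0∞) /
    ((Real.log (1 / ε) : ℝ) : EReal)) (𝓝[>] 0)

/-- `f ≳ g` as `r → ∞`, that is, `liminf f / g ≥ 1`. The function `f` may take the value `+∞`. -/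
def AsympGE (f : ℝ → EReal) (g : ℝ → ℝ) : Prop :=
  1 ≤ liminf (fun r => f r / ((g r : ℝ) : EReal)) atTop

end JumpCoding

namespace JumpCoding

/-! A path with `k` jumps is described by `k` times and `k + 1` values. Rounding the times down to a
grid and the values to a net of `E` gives precision about `exp (-L)` at a cost of about `(k + 1) (1
+ γ) L`, so rate `r` buys `L ≈ r / ((1 + γ) (k + 1))`. The codebooks for all `k ≤ √r` are united, at
a cost only logarithmic in `r` (`eventually_exists_codebook`); paths with more jumps get the trivial
error `w`. In the `s`-th moment, `k` jumps contribute the exponent `-(k log k + s r / ((1 + γ) k))`,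
up to lower order. Near the critical `k`, which is `√r` up to logarithmic factors, `log k ≈ (log r)
/ 2`, and AM-GM bounds the sum of the two terms below by `√(2 s r log r / (1 + γ))`
(`eventually_weighted_error_le`). The `s`-th root gives the claimed constant. Losses are collected
in a factor `q < 1`, which tends to `1` at the end (`asympGE_neg_log`). -/

/-! ### Paths as step functions -/

/-- The witness set `S` may contain points that are not jumps. Its last point `v` in `(t, u]` is
crossed by stepping to some `x < v` with the same value, which leaves fewer points of `S` to cross.
-/
theorem eq_of_forall_notMem_jumpSet {E : Type*} (f : JumpPath E) {t u : Time} (htu : t ≤ u)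
    (h : ∀ v, t < v → v ≤ u → v ∉ jumpSet f) : f t = f u := by
  classical
  obtain ⟨S, hS⟩ := f.piecewiseConst'
  induction hn : (S.filter fun v => t < v ∧ v ≤ u).card using Nat.strong_induction_on
    generalizing u with
  | _ n ih =>
    subst hn
    rcases (S.filter fun v => t < v ∧ v ≤ u).eq_empty_or_nonempty with he | hne
    · refine hS t u htu fun v hv hvu => ?_
      have : v ∈ S.filter fun v => t < v ∧ v ≤ u := Finset.mem_filter.mpr ⟨hv, hvu⟩
      simp [he] at this
    · obtain ⟨v, hv, hmax⟩ := Finset.exists_max_image _ id hne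
      obtain ⟨hvS, htv, hvu⟩ := Finset.mem_filter.mp hv
      have hfv : f v = f u := by
        refine hS v u hvu fun x hx hxu => ?_
        have := hmax x (Finset.mem_filter.mpr ⟨hx, htv.trans hxu.1, hxu.2⟩)
        exact absurd hxu.1 (not_lt.mpr this)
      have hev : ∀ᶠ x in 𝓝[<] v, f x = f v := not_not.mp (h v htv hvu)
      have : (𝓝[<] v).NeBot := nhdsLT_neBot_of_exists_lt ⟨t, htv⟩
      obtain ⟨x, ⟨hx, hxv⟩, htx⟩ := ((hev.and self_mem_nhdsWithin).and
        (eventually_nhdsWithin_of_eventually_nhds (eventually_gt_nhds htv))).exists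
      have hxv : x < v := hxv
      rw [← hfv, ← hx]
      refine ih _ ?_ htx.le (fun y hty hyx => h y hty (hyx.trans (hxv.le.trans hvu))) rfl
      refine Finset.card_lt_card ⟨fun y hy => ?_, fun hsub => ?_⟩
      · obtain ⟨h1, h2, h3⟩ := Finset.mem_filter.mp hy
        exact Finset.mem_filter.mpr ⟨h1, h2, h3.trans (hxv.le.trans hvu)⟩
      · exact absurd (Finset.mem_filter.mp (hsub hv)).2.2 (not_le.mpr hxv)

/-- The number of the points `τ i` up to time `u`. -/
noncomputable def countUpTo {k : ℕ} (τ : Fin k → Time) (u : Time) : Fin (k + 1) :=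
  ⟨(Finset.univ.filter fun i => τ i ≤ u).card,
    Nat.lt_succ_of_le ((Finset.card_filter_le _ _).trans (by simp))⟩

/-- The path that takes the value `v j` while exactly `j` of the points `τ i` have passed. -/
noncomputable def stepPath {E : Type*} {k : ℕ} (τ : Fin k → Time) (v : Fin (k + 1) → E) :
    JumpPath E where
  toFun u := v (countUpTo τ u)
  piecewiseConst' := by
    classical
    refine ⟨Finset.univ.image τ, fun t u htu h => ?_⟩
    have : countUpTo τ t = countUpTo τ u := by
      unfold countUpTo
      congr 2
      ext i
      simp only [Finset.mem_filter, Finset.mem_univ, true_and]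
      refine ⟨fun hi => hi.trans htu, fun hi => ?_⟩
      by_contra hti
      exact h (τ i) (Finset.mem_image_of_mem _ (Finset.mem_univ i)) ⟨not_le.mp hti, hi⟩
    rw [this]

theorem exists_eq_stepPath {E : Type*} (f : JumpPath E) :
    ∃ (τ : Fin (jumpCount f) → Time) (v : Fin (jumpCount f + 1) → E),
      ∀ u, f u = stepPath τ v u := by
  classical
  have hfin := jumpSet_finite f
  let J := hfin.toFinset
  have hJ : J.card = jumpCount f := (Set.ncard_eq_toFinset_card _ hfin).symm
  let e := (J.equivFinOfCardEq hJ).symm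
  let τ : Fin (jumpCount f) → Time := fun i => (e i : Time)
  have key : ∀ t u, t ≤ u → countUpTo τ t = countUpTo τ u → f t = f u := by
    intro t u htu h
    refine eq_of_forall_notMem_jumpSet f htu fun x hx hxu hxJ => ?_
    have hxJ' : x ∈ J := hfin.mem_toFinset.mpr hxJ
    have hsub : (Finset.univ.filter fun i => τ i ≤ t) ⊆ Finset.univ.filter fun i => τ i ≤ u := by
      intro i hi
      simp only [Finset.mem_filter, Finset.mem_univ, true_and] at hi ⊢
      exact hi.trans htu
    have heq := Finset.eq_of_subset_of_card_le hsub (Fin.ext_iff.mp h).ge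
    have hτ : τ (e.symm ⟨x, hxJ'⟩) = x := by simp [τ]
    have : e.symm ⟨x, hxJ'⟩ ∈ Finset.univ.filter fun i => τ i ≤ u := by
      simp only [Finset.mem_filter, Finset.mem_univ, true_and, hτ, hxu]
    rw [← heq] at this
    simp only [Finset.mem_filter, Finset.mem_univ, true_and, hτ] at this
    exact absurd hx (not_lt.mpr this)
  -- By `key`, `f` depends only on the count, so any time with count `j` supplies the value; the
  -- default is never evaluated.
  refine ⟨τ, fun j => if h : ∃ u, countUpTo τ u = j then f h.choose else f ⟨0, by simp⟩,
    fun u => ?_⟩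
  have hex : ∃ u', countUpTo τ u' = countUpTo τ u := ⟨u, rfl⟩
  change f u = dite _ _ _
  rw [dif_pos hex]
  rcases le_total u hex.choose with h | h
  · exact key _ _ h hex.choose_spec.symm
  · exact (key _ _ h hex.choose_spec).symm

/-! ### Rounding jump times and values -/

/-- The largest multiple of `1 / M` that is at most `t`. -/
noncomputable def gridFloor (M : ℕ) (hM : 0 < M) (t : Time) : Fin M :=
  ⟨⌊(M : ℝ) * t⌋₊, by
    have hM' : (0 : ℝ) < M := Nat.cast_pos.mpr hM
    rw [Nat.floor_lt (mul_nonneg hM'.le t.2.1)]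
    nlinarith [t.2.2]⟩

noncomputable def gridPoint (M : ℕ) (i : Fin M) : Time :=
  ⟨(i : ℝ) / M, by positivity, by
    have hM' : (0 : ℝ) < M := Nat.cast_pos.mpr i.pos
    rw [div_lt_one hM']
    exact_mod_cast i.2⟩

theorem gridPoint_gridFloor_le (M : ℕ) (hM : 0 < M) (t : Time) :
    gridPoint M (gridFloor M hM t) ≤ t := by
  have hM' : (0 : ℝ) < M := Nat.cast_pos.mpr hM
  change (⌊(M : ℝ) * t⌋₊ : ℝ) / M ≤ t
  rw [div_le_iff₀ hM', mul_comm (t : ℝ)]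
  exact Nat.floor_le (mul_nonneg hM'.le t.2.1)

theorem sub_gridPoint_gridFloor_le (M : ℕ) (hM : 0 < M) (t : Time) :
    (t : ℝ) - gridPoint M (gridFloor M hM t) ≤ 1 / M := by
  have hM' : (0 : ℝ) < M := Nat.cast_pos.mpr hM
  change (t : ℝ) - (⌊(M : ℝ) * t⌋₊ : ℝ) / M ≤ 1 / M
  rw [sub_le_iff_le_add, ← add_div, le_div_iff₀ hM', mul_comm (t : ℝ), add_comm]
  exact (Nat.lt_floor_add_one _).le

theorem comap_val_univ : Measure.comap (Subtype.val : Time → ℝ) volume Set.univ = 1 := by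
  rw [(MeasurableEmbedding.subtype_coe measurableSet_Ico).comap_apply,
    Set.image_univ, Subtype.range_coe, Real.volume_Ico]
  simp

theorem comap_val_Ico_le (a b : Time) :
    Measure.comap (Subtype.val : Time → ℝ) volume (Set.Ico a b) ≤
      ENNReal.ofReal ((b : ℝ) - a) := by
  rw [(MeasurableEmbedding.subtype_coe measurableSet_Ico).comap_apply, ← Real.volume_Ico]
  refine measure_mono ?_
  rintro _ ⟨u, hu, rfl⟩
  exact ⟨hu.1, hu.2⟩

theorem pathDistortion_le_of_le {E : Type*} {ρ : E → E → ℝ≥0} {w : ℝ≥0}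
    (hw : ∀ x y, ρ x y ≤ w) (f g : JumpPath E) : pathDistortion ρ f g ≤ w := by
  calc pathDistortion ρ f g
      ≤ ∫⁻ _ : Time, (w : ℝ≥0∞) ∂(Measure.comap Subtype.val volume) :=
        lintegral_mono fun t => ENNReal.coe_le_coe.mpr (hw _ _)
    _ = w := by rw [lintegral_const, comap_val_univ, mul_one]

/-- Off the intervals `[σ i, τ i)` both paths have the same count, so corresponding values are
compared directly and no triangle inequality is needed. On these intervals the bound `w` is used.
Times need be neither ordered nor distinct, so rounding may merge them. -/
theorem pathDistortion_stepPath_le {E : Type*} {ρ : E → E → ℝ≥0} {w ε : ℝ≥0}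
    (hw : ∀ x y, ρ x y ≤ w) {k : ℕ} {τ σ : Fin k → Time} {v v' : Fin (k + 1) → E} {h : ℝ}
    (hv : ∀ j, ρ (v j) (v' j) ≤ ε) (hle : ∀ i, σ i ≤ τ i)
    (hστ : ∀ i, (τ i : ℝ) - σ i ≤ h) {f : JumpPath E} (hf : ∀ u, f u = stepPath τ v u) :
    pathDistortion ρ f (stepPath σ v') ≤ ε + w * (k * ENNReal.ofReal h) := by
  have hmeas : MeasurableSet (⋃ i, Set.Ico (σ i) (τ i)) :=
    MeasurableSet.iUnion fun i => measurableSet_Ico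
  calc pathDistortion ρ f (stepPath σ v')
      ≤ ∫⁻ u : Time, ((ε : ℝ≥0∞) + (⋃ i, Set.Ico (σ i) (τ i)).indicator (fun _ => (w : ℝ≥0∞)) u)
          ∂(Measure.comap Subtype.val volume) := by
        refine lintegral_mono fun u => ?_
        by_cases hu : u ∈ ⋃ i, Set.Ico (σ i) (τ i)
        · rw [Set.indicator_of_mem hu]
          exact le_add_left (ENNReal.coe_le_coe.mpr (hw _ _))
        · rw [Set.indicator_of_notMem hu, add_zero, ENNReal.coe_le_coe, hf u]
          have : countUpTo τ u = countUpTo σ u := by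
            unfold countUpTo
            congr 2
            ext i
            simp only [Finset.mem_filter, Finset.mem_univ, true_and]
            refine ⟨fun hi => (hle i).trans hi, fun hi => ?_⟩
            by_contra hti
            exact hu (Set.mem_iUnion.mpr ⟨i, hi, not_le.mp hti⟩)
          change ρ (v (countUpTo τ u)) (v' (countUpTo σ u)) ≤ ε
          rw [this]
          exact hv _
    _ = ε + w * Measure.comap (Subtype.val : Time → ℝ) volume (⋃ i, Set.Ico (σ i) (τ i)) := by
        rw [lintegral_add_left measurable_const, lintegral_const, comap_val_univ, mul_one,
          lintegral_indicator_const hmeas]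
    _ ≤ ε + w * (k * ENNReal.ofReal h) := by
        gcongr
        calc Measure.comap (Subtype.val : Time → ℝ) volume (⋃ i, Set.Ico (σ i) (τ i))
            ≤ ∑ i, Measure.comap (Subtype.val : Time → ℝ) volume (Set.Ico (σ i) (τ i)) :=
              measure_iUnion_fintype_le _ _
          _ ≤ ∑ _i : Fin k, ENNReal.ofReal h :=
              Finset.sum_le_sum fun i _ => (comap_val_Ico_le _ _).trans
                (ENNReal.ofReal_le_ofReal (hστ i))
          _ = k * ENNReal.ofReal h := by simp

theorem exists_codebook {E : Type*} [Nonempty E] {ρ : E → E → ℝ≥0} {w ε : ℝ≥0}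
    (hw : ∀ x y, ρ x y ≤ w) {N : ℕ} {x : Fin N → E} (hx : ∀ y, ∃ i, ρ y (x i) ≤ ε)
    (k M : ℕ) (hM : 0 < M) :
    ∃ C : Finset (JumpPath E), C.Nonempty ∧ C.card ≤ M ^ k * N ^ (k + 1) ∧
      ∀ f, jumpCount f = k → ∃ a ∈ C,
        pathDistortion ρ f a ≤ ε + w * (k * ENNReal.ofReal (1 / M)) := by
  classical
  let c : (Fin k → Fin M) × (Fin (k + 1) → Fin N) → JumpPath E :=
    fun p => stepPath (fun i => gridPoint M (p.1 i)) (fun j => x (p.2 j))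
  refine ⟨Finset.univ.image c, ?_, ?_, ?_⟩
  · obtain ⟨i, -⟩ := hx (Classical.arbitrary E)
    exact ⟨c (fun _ => ⟨0, hM⟩, fun _ => i), Finset.mem_image_of_mem _ (Finset.mem_univ _)⟩
  · exact Finset.card_image_le.trans (by simp)
  · rintro f rfl
    obtain ⟨τ, v, hf⟩ := exists_eq_stepPath f
    choose g hg using hx
    refine ⟨c (fun i => gridFloor M hM (τ i), fun j => g (v j)),
      Finset.mem_image_of_mem _ (Finset.mem_univ _), ?_⟩
    exact pathDistortion_stepPath_le hw (fun j => hg _)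
      (fun i => gridPoint_gridFloor_le M hM (τ i))
      (fun i => sub_gridPoint_gridFloor_le M hM (τ i)) hf

/-! ### Splitting the error by the number of jumps -/

/-- Replacing the level sets of `N` by measurable hulls of equal measure makes measurability of `N`
and `F` unnecessary. -/
theorem lintegral_le_tsum_of_le {Ω : Type*} [MeasurableSpace Ω] (P : Measure Ω)
    (N : Ω → ℕ) (e : ℕ → ℝ≥0∞) {F : Ω → ℝ≥0∞} (hF : ∀ ω, F ω ≤ e (N ω)) :
    ∫⁻ ω, F ω ∂P ≤ ∑' k, e k * P {ω | N ω = k} := by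
  have hmeas : ∀ k, MeasurableSet (toMeasurable P {ω | N ω = k}) := fun k =>
    measurableSet_toMeasurable _ _
  calc ∫⁻ ω, F ω ∂P
      ≤ ∫⁻ ω, ∑' k, (toMeasurable P {ω | N ω = k}).indicator (fun _ => e k) ω ∂P := by
        refine lintegral_mono fun ω => (hF ω).trans ?_
        refine le_trans ?_ (ENNReal.le_tsum (N ω))
        rw [Set.indicator_of_mem (subset_toMeasurable P _ (by exact rfl))]
    _ = ∑' k, e k * P {ω | N ω = k} := by
        rw [lintegral_tsum fun k => (measurable_const.indicator (hmeas k)).aemeasurable]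
        refine tsum_congr fun k => ?_
        rw [lintegral_indicator_const (hmeas k), measure_toMeasurable]

theorem quantError_le {Ω A : Type*} [MeasurableSpace Ω] (P : Measure Ω) (X : Ω → A)
    (d : A → A → ℝ≥0∞) {s r : ℝ} (hs : 0 < s) {C : Finset A} (hC : C.Nonempty)
    (hr : Real.log (C.card : ℝ) ≤ r) (N : A → ℕ) (e : ℕ → ℝ≥0∞)
    (h : ∀ f, ∃ a ∈ C, d f a ≤ e (N f)) :
    quantError P X d s r ≤ (∑' k, e k ^ s * P {ω | N (X ω) = k}) ^ (1 / s) := by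
  refine (iInf₂_le_of_le C hC (iInf_le _ hr)).trans ?_
  refine ENNReal.rpow_le_rpow ?_ (by positivity)
  refine lintegral_le_tsum_of_le P (fun ω => N (X ω)) (fun k => e k ^ s) fun ω => ?_
  obtain ⟨a, ha, hle⟩ := h (X ω)
  exact (iInf₂_le a ha).trans (ENNReal.rpow_le_rpow hle hs.le)


/-! ### Nets from the upper box dimension -/

theorem one_le_coveringNumber {E : Type*} [Nonempty E] (ρ : E → E → ℝ≥0) (ε : ℝ) :
    1 ≤ coveringNumber ρ ε := by
  refine le_iInf₂ fun n hn => ?_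
  obtain ⟨x, hx⟩ := hn
  obtain ⟨i, -⟩ := hx (Classical.arbitrary E)
  exact_mod_cast i.pos

theorem upperBoxDim_nonneg {E : Type*} [Nonempty E] (ρ : E → E → ℝ≥0) : 0 ≤ upperBoxDim ρ := by
  refine le_limsup_of_frequently_le (Eventually.frequently ?_)
  filter_upwards [Ioo_mem_nhdsGT (zero_lt_one' ℝ)] with ε hε
  refine EReal.div_nonneg ?_ ?_
  · rw [ENNReal.zero_le_log_iff]
    exact_mod_cast one_le_coveringNumber ρ ε
  · exact_mod_cast Real.log_nonneg (one_le_one_div hε.1 hε.2.le)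

theorem exists_net_of_coveringNumber_ne_top {E : Type*} {ρ : E → E → ℝ≥0} {ε : ℝ}
    (h : coveringNumber ρ ε ≠ ⊤) :
    ∃ (N : ℕ) (x : Fin N → E), (N : ℕ∞) ≤ coveringNumber ρ ε ∧
      ∀ y, ∃ i, (ρ y (x i) : ℝ) ≤ ε := by
  obtain ⟨m, hm⟩ := ENat.ne_top_iff_exists.mp h
  have hlt : coveringNumber ρ ε < ((m + 1 : ℕ) : ℕ∞) := by
    rw [← hm]
    exact_mod_cast Nat.lt_succ_self m
  unfold coveringNumber at hlt
  obtain ⟨n, hn⟩ := iInf_lt_iff.mp hlt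
  obtain ⟨⟨x, hx⟩, hn⟩ := iInf_lt_iff.mp hn
  refine ⟨n, x, ?_, hx⟩
  rw [← hm]
  have : n < m + 1 := by exact_mod_cast hn
  exact_mod_cast Nat.lt_succ_iff.mp this

theorem eventually_exists_net {E : Type*} {ρ : E → E → ℝ≥0} {β : ℝ}
    (hβ : upperBoxDim ρ < (β : EReal)) :
    ∀ᶠ L : ℝ in atTop, ∃ (N : ℕ) (x : Fin N → E), (N : ℝ) ≤ Real.exp (β * L) ∧
      ∀ y, ∃ i, (ρ y (x i) : ℝ) ≤ Real.exp (-L) := by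
  have hlim : Tendsto (fun L : ℝ => Real.exp (-L)) atTop (𝓝[>] 0) :=
    tendsto_nhdsWithin_iff.mpr ⟨Real.tendsto_exp_neg_atTop_nhds_zero,
      Eventually.of_forall fun L => Real.exp_pos _⟩
  filter_upwards [hlim.eventually (eventually_lt_of_limsup_lt hβ), eventually_gt_atTop 0]
    with L hL hL0
  have hlog : Real.log (1 / Real.exp (-L)) = L := by
    rw [one_div, ← Real.exp_neg, neg_neg, Real.log_exp]
  rw [hlog, EReal.div_lt_iff (by exact_mod_cast hL0) (EReal.coe_ne_top L), ← EReal.coe_mul,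
    ← EReal.log_exp ((β * L : ℝ) : EReal), ENNReal.log_lt_log_iff, EReal.exp_coe] at hL
  have hne : coveringNumber ρ (Real.exp (-L)) ≠ ⊤ := by
    intro h
    rw [h] at hL
    simp at hL
  obtain ⟨N, x, hN, hx⟩ := exists_net_of_coveringNumber_ne_top hne
  refine ⟨N, x, ?_, hx⟩
  have h1 : ((N : ℕ∞) : ℝ≥0∞) ≤ ((coveringNumber ρ (Real.exp (-L)) : ℕ∞) : ℝ≥0∞) := by
    exact_mod_cast hN
  have h2 := h1.trans hL.le
  rw [ENat.toENNReal_coe, ← ENNReal.ofReal_natCast,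
    ENNReal.ofReal_le_ofReal_iff (Real.exp_pos _).le] at h2
  exact h2

/-! ### Codebooks of prescribed rate -/

/-- A codebook for the paths with `k` jumps at precision `exp (-L)`. -/
theorem exists_codebook_exp {E : Type*} [Nonempty E] {ρ : E → E → ℝ≥0} {w : ℝ≥0}
    (hw : ∀ x y, ρ x y ≤ w) {β η L : ℝ} {N : ℕ} {x : Fin N → E} (hL : 0 ≤ L) (hη : 0 ≤ η)
    (hN : (N : ℝ) ≤ Real.exp (β * L)) (hx : ∀ y, ∃ i, (ρ y (x i) : ℝ) ≤ Real.exp (-L))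
    {k : ℕ} (hk : Real.log (k + 2) ≤ η * L) :
    ∃ C : Finset (JumpPath E), C.Nonempty ∧
      (C.card : ℝ) ≤ Real.exp ((k + 1) * ((1 + η + β) * L)) ∧
      ∀ f, jumpCount f = k → ∃ a ∈ C,
        pathDistortion ρ f a ≤ ENNReal.ofReal ((1 + w) * Real.exp (-L)) := by
  -- This makes the total time shift `k / M` at most `exp (-L)`; the extra factor `k + 2` in the
  -- size of `M` is paid for by `η`.
  set M : ℕ := ⌈((k : ℝ) + 1) * Real.exp L⌉₊ with hM
  have hpos : 0 < ((k : ℝ) + 1) * Real.exp L := by positivity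
  have hM0 : 0 < M := Nat.ceil_pos.mpr hpos
  have hMle : (M : ℝ) ≤ Real.exp ((1 + η) * L) := by
    calc (M : ℝ) ≤ ((k : ℝ) + 1) * Real.exp L + 1 := (Nat.ceil_lt_add_one hpos.le).le
      _ ≤ ((k : ℝ) + 2) * Real.exp L := by nlinarith [Real.one_le_exp hL]
      _ ≤ Real.exp (η * L) * Real.exp L := by
        gcongr
        rw [← Real.exp_log (show (0 : ℝ) < k + 2 by positivity)]
        exact Real.exp_le_exp.mpr hk
      _ = Real.exp ((1 + η) * L) := by rw [← Real.exp_add]; ring_nf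
  let ε : ℝ≥0 := ⟨Real.exp (-L), (Real.exp_pos _).le⟩
  obtain ⟨C, hC, hcard, hCd⟩ := exists_codebook (ε := ε) hw (x := x) hx k M hM0
  refine ⟨C, hC, ?_, fun f hf => ?_⟩
  · calc (C.card : ℝ) ≤ (M : ℝ) ^ k * (N : ℝ) ^ (k + 1) := by exact_mod_cast hcard
      _ ≤ Real.exp ((1 + η) * L) ^ (k + 1) * Real.exp (β * L) ^ (k + 1) := by
        gcongr
        calc (M : ℝ) ^ k ≤ Real.exp ((1 + η) * L) ^ k := by gcongr
          _ ≤ Real.exp ((1 + η) * L) ^ (k + 1) :=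
            pow_le_pow_right₀ (Real.one_le_exp (by positivity)) (Nat.le_succ k)
      _ = Real.exp ((k + 1) * ((1 + η + β) * L)) := by
        rw [← mul_pow, ← Real.exp_add, ← Real.exp_nat_mul]
        push_cast
        ring_nf
  · obtain ⟨a, ha, hle⟩ := hCd f hf
    refine ⟨a, ha, hle.trans ?_⟩
    have hkM : (k : ℝ) * (1 / M) ≤ Real.exp (-L) := by
      rw [mul_one_div, div_le_iff₀ (Nat.cast_pos.mpr hM0), Real.exp_neg,
        ← div_eq_inv_mul, le_div_iff₀ (Real.exp_pos L)]
      exact (mul_le_mul_of_nonneg_right (by linarith) (Real.exp_pos L).le).trans (Nat.le_ceil _)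
    have hε : (ε : ℝ≥0∞) = ENNReal.ofReal (Real.exp (-L)) :=
      (ENNReal.ofReal_eq_coe_nnreal (Real.exp_pos _).le).symm
    calc _ = ENNReal.ofReal (Real.exp (-L) + w * (k * (1 / M))) := by
          rw [hε, ENNReal.ofReal_add (by positivity) (by positivity),
            ENNReal.ofReal_mul (by positivity), ENNReal.ofReal_mul (by positivity)]
          simp
      _ ≤ ENNReal.ofReal ((1 + w) * Real.exp (-L)) := by
        refine ENNReal.ofReal_le_ofReal ?_
        nlinarith [mul_le_mul_of_nonneg_left hkM w.coe_nonneg]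

/-- A codebook of rate `r` that is fitted to the number of jumps, up to `√r` jumps. -/
theorem eventually_exists_codebook {E : Type*} [Nonempty E] {ρ : E → E → ℝ≥0} {w : ℝ≥0}
    (hw : ∀ x y, ρ x y ≤ w) {γ : ℝ} (hγ0 : 0 ≤ γ) (hγ : upperBoxDim ρ = (γ : EReal))
    {q : ℝ} (hq0 : 0 < q) (hq1 : q < 1) :
    ∀ᶠ r : ℝ in atTop, ∃ C : Finset (JumpPath E), C.Nonempty ∧ Real.log C.card ≤ r ∧
      ∀ f, ∃ a ∈ C, pathDistortion ρ f a ≤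
        if jumpCount f ≤ ⌊√r⌋₊ then
          ENNReal.ofReal ((1 + w) * Real.exp (-(q * r / (1 + γ) / (jumpCount f + 1))))
        else (w : ℝ≥0∞) := by
  classical
  -- `η` is spent twice, on the net and on the grid, and solves `(1 + γ + 2 η) q / (1 + γ) = (1 + q)
  -- / 2`. The remaining rate `(1 - q) / 2 * r` pays for the union over `k`.
  set η : ℝ := (1 + γ) * (1 - q) / (4 * q) with hη
  have hη0 : 0 < η := by
    have : 0 < 1 - q := by linarith
    positivity
  have hA : 0 < q / (2 * (1 + γ)) := by positivity
  have hγη : upperBoxDim ρ < ((γ + η : ℝ) : EReal) := by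
    rw [hγ]
    exact_mod_cast lt_add_of_pos_right γ hη0
  obtain ⟨L₀, hL₀⟩ := eventually_atTop.mp (eventually_exists_net hγη)
  have hsqrt := Real.tendsto_sqrt_atTop
  have hlog : ∀ c : ℝ, 0 < c → ∀ᶠ x : ℝ in atTop, Real.log x ≤ c * x := fun c hc => by
    filter_upwards [Real.isLittleO_log_id_atTop.bound hc, eventually_ge_atTop 0] with x hx hx0
    exact (Real.le_norm_self _).trans (hx.trans_eq (by rw [id, Real.norm_of_nonneg hx0]))
  have h1 : ∀ᶠ r : ℝ in atTop, Real.log (√r + 2) ≤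
      (η * (q / (2 * (1 + γ))) / 3) * (√r + 2) :=
    (tendsto_atTop_add_const_right _ 2 hsqrt).eventually (hlog _ (by positivity))
  have h2 : ∀ᶠ r : ℝ in atTop, Real.log (r + 1) ≤ ((1 - q) / 4) * (r + 1) :=
    (tendsto_atTop_add_const_right _ 1 tendsto_id).eventually
      (hlog _ (by linarith))
  filter_upwards [h1, h2, eventually_ge_atTop 1,
    hsqrt.eventually_ge_atTop (max 0 (L₀ / (q / (2 * (1 + γ)))))] with r h1 h2 hr1 h3
  have hs1 : 1 ≤ √r := Real.one_le_sqrt.mpr hr1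
  have hsr : √r * √r = r := Real.mul_self_sqrt (by linarith)
  set n := ⌊√r⌋₊ with hn
  have hnr : (n : ℝ) ≤ √r := Nat.floor_le (Real.sqrt_nonneg r)
  have hk : ∀ k ∈ Finset.range (n + 1), ∃ C : Finset (JumpPath E), C.Nonempty ∧
      (C.card : ℝ) ≤ Real.exp ((1 + q) / 2 * r) ∧
      ∀ f, jumpCount f = k → ∃ a ∈ C, pathDistortion ρ f a ≤
        ENNReal.ofReal ((1 + w) * Real.exp (-(q * r / (1 + γ) / (k + 1)))) := by
    intro k hk
    have hkr : (k : ℝ) ≤ √r := by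
      have : (k : ℝ) ≤ n := by exact_mod_cast Nat.lt_succ_iff.mp (Finset.mem_range.mp hk)
      linarith
    -- The cutoff `k ≤ √r` keeps the precision exponent of order at least `√r`, so the asymptotic
    -- net bound applies uniformly in `k`.
    have hL : q / (2 * (1 + γ)) * √r ≤ q * r / (1 + γ) / (k + 1) := by
      rw [le_div_iff₀ (by positivity)]
      calc q / (2 * (1 + γ)) * √r * (k + 1) ≤ q / (2 * (1 + γ)) * √r * (2 * √r) := by
            gcongr; linarith
        _ = q * (√r * √r) / (1 + γ) := by field_simp
        _ = q * r / (1 + γ) := by rw [hsr]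
    obtain ⟨N, x, hN, hx⟩ := hL₀ (q * r / (1 + γ) / (k + 1)) (by
      refine le_trans ?_ hL
      have := (le_max_right _ _).trans h3
      rw [div_le_iff₀ hA] at this
      linarith)
    obtain ⟨C, hC, hcard, hCd⟩ := exists_codebook_exp hw (η := η) (k := k) (by positivity)
      hη0.le hN hx (by
        calc Real.log (k + 2) ≤ Real.log (√r + 2) :=
              Real.log_le_log (by positivity) (by linarith)
          _ ≤ (η * (q / (2 * (1 + γ))) / 3) * (√r + 2) := h1
          _ ≤ (η * (q / (2 * (1 + γ))) / 3) * (3 * √r) := by gcongr; linarith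
          _ = η * (q / (2 * (1 + γ)) * √r) := by ring
          _ ≤ _ := by gcongr)
    refine ⟨C, hC, hcard.trans_eq ?_, hCd⟩
    congr 1
    rw [hη]
    field_simp
    ring
  choose! C hCne hCcard hCd using hk
  refine ⟨(Finset.range (n + 1)).biUnion C, ?_, ?_, fun f => ?_⟩
  · exact (hCne 0 (by simp)).mono (Finset.subset_biUnion_of_mem C (by simp))
  · rcases Nat.eq_zero_or_pos ((Finset.range (n + 1)).biUnion C).card with h0 | h0
    · rw [h0]; simp; linarith
    rw [Real.log_le_iff_le_exp (by exact_mod_cast h0)]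
    have hn1 : (n : ℝ) + 1 ≤ Real.exp ((1 - q) / 2 * r) := by
      calc (n : ℝ) + 1 ≤ r + 1 := by nlinarith
        _ = Real.exp (Real.log (r + 1)) := (Real.exp_log (by linarith)).symm
        _ ≤ Real.exp ((1 - q) / 2 * r) := by
          refine Real.exp_le_exp.mpr (h2.trans ?_)
          nlinarith
    calc (((Finset.range (n + 1)).biUnion C).card : ℝ)
        ≤ ∑ k ∈ Finset.range (n + 1), ((C k).card : ℝ) := by
          exact_mod_cast Finset.card_biUnion_le
      _ ≤ ∑ _k ∈ Finset.range (n + 1), Real.exp ((1 + q) / 2 * r) :=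
          Finset.sum_le_sum hCcard
      _ = ((n : ℝ) + 1) * Real.exp ((1 + q) / 2 * r) := by simp
      _ ≤ Real.exp ((1 - q) / 2 * r) * Real.exp ((1 + q) / 2 * r) := by gcongr
      _ = Real.exp r := by rw [← Real.exp_add]; ring_nf
  · split_ifs with hf
    · have hmem : jumpCount f ∈ Finset.range (n + 1) :=
        Finset.mem_range.mpr (Nat.lt_succ_of_le hf)
      obtain ⟨a, ha, hle⟩ := hCd _ hmem f rfl
      exact ⟨a, Finset.mem_biUnion.mpr ⟨_, hmem, ha⟩, hle⟩
    · obtain ⟨a, ha⟩ := hCne 0 (by simp)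
      exact ⟨a, Finset.mem_biUnion.mpr ⟨0, by simp, ha⟩, pathDistortion_le_of_le hw f a⟩


/-! ### Factorial decay against coding precision -/

theorem le_add_of_sq_le_four_mul {x y z : ℝ} (hx : 0 ≤ x) (hy : 0 ≤ y) (h : z ^ 2 ≤ 4 * x * y) :
    z ≤ x + y :=
  le_of_sq_le_sq (h.trans (by nlinarith [sq_nonneg (x - y)])) (by positivity)

/-- With `T = r ^ α`, the bound `T ^ k / k! ≤ exp T ≤ exp (k + 1)` replaces Stirling's formula. -/
theorem eventually_pow_div_factorial_le {q α c : ℝ} (hq : 0 < q) (hα : q / 2 < α) (hc : 0 < c) :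
    ∀ᶠ r : ℝ in atTop, ∀ k : ℕ, r ^ α ≤ (k : ℝ) + 1 →
      c ^ k / (k.factorial : ℝ) ≤ Real.exp (1 - q / 2 * Real.log r * (k + 1)) := by
  -- The gap `α - β` absorbs `log c + 1`; the gap `β - q / 2` absorbs the shift from `k` to `k + 1`.
  set β := (α + q / 2) / 2 with hβ
  have hβα : 0 < α - β := by rw [hβ]; linarith
  have hβq : 0 < β - q / 2 := by rw [hβ]; linarith
  filter_upwards [Real.tendsto_log_atTop.eventually_ge_atTop ((Real.log c + 1) / (α - β)),
    (tendsto_rpow_atTop (show 0 < α by linarith)).eventually_ge_atTop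
      (1 + q / 2 / (β - q / 2)), eventually_gt_atTop 1] with r h1 h2 hr k hk
  have hr0 : 0 < r := by linarith
  have hlr : 0 < Real.log r := Real.log_pos hr
  have hT : 0 < r ^ α := Real.rpow_pos_of_pos hr0 α
  rw [div_le_iff₀ hβα] at h1
  have h3 : q / 2 ≤ k * (β - q / 2) := by
    rw [← div_le_iff₀ hβq]
    linarith
  have h4 := mul_le_mul_of_nonneg_right h3 hlr.le
  have h5 := mul_le_mul_of_nonneg_left h1 (Nat.cast_nonneg (α := ℝ) k)
  calc c ^ k / (k.factorial : ℝ)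
      = (c / r ^ α) ^ k * ((r ^ α) ^ k / (k.factorial : ℝ)) := by
        rw [div_pow]
        field_simp
    _ ≤ (c / r ^ α) ^ k * Real.exp (r ^ α) := by
        gcongr
        exact Real.pow_div_factorial_le_exp _ hT.le k
    _ = Real.exp (k * (Real.log c - α * Real.log r) + r ^ α) := by
        rw [Real.exp_add, Real.exp_nat_mul, Real.exp_sub, Real.exp_log hc, mul_comm α,
          ← Real.rpow_def_of_pos hr0]
    _ ≤ Real.exp (1 - q / 2 * Real.log r * (k + 1)) := by
        refine Real.exp_le_exp.mpr ?_
        nlinarith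

/-- Below `r ^ α`, with `α` just under `1 / 2`, precision alone suffices; from there on, AM-GM
balances precision against factorial decay; from `√r` on, factorial decay alone suffices. -/
theorem eventually_weighted_error_le {q c D : ℝ} (hq : 0 < q) (hq1 : q < 1) (hc : 0 < c)
    (hD : 0 < D) :
    ∀ᶠ r : ℝ in atTop, ∀ k : ℕ,
      c ^ k / (k.factorial : ℝ) * Real.exp (-(D * r / (k + 1))) ≤
        Real.exp (c + 1) * Real.exp (-√(2 * D * q * (r * Real.log r))) ∧
      (√r ≤ (k : ℝ) + 1 → c ^ k / (k.factorial : ℝ) ≤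
        Real.exp (c + 1) * Real.exp (-√(2 * D * q * (r * Real.log r)))) := by
  obtain ⟨α, hα, hα2⟩ := exists_between (show q / 2 < 1 / 2 by linarith)
  have hlo : ∀ᶠ r : ℝ in atTop, Real.log r ≤ D / (2 * q) * r ^ (1 - 2 * α) := by
    filter_upwards [(isLittleO_log_rpow_atTop (show 0 < 1 - 2 * α by linarith)).bound
      (show 0 < D / (2 * q) by positivity), eventually_ge_atTop 0] with r h hr
    refine (Real.le_norm_self _).trans (h.trans_eq ?_)
    rw [Real.norm_of_nonneg (Real.rpow_nonneg hr _)]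
  filter_upwards [eventually_pow_div_factorial_le hq hα hc, hlo, eventually_gt_atTop 1,
    Real.tendsto_log_atTop.eventually_ge_atTop (8 * D / q)] with r hfac hlo hr h8 k
  have hr0 : 0 < r := by linarith
  have hlr : 0 < Real.log r := Real.log_pos hr
  have hα0 : 0 < α := by linarith
  set Z := √(2 * D * q * (r * Real.log r)) with hZ
  have hZsq : Z ^ 2 = 2 * D * q * (r * Real.log r) := Real.sq_sqrt (by positivity)
  have hk1 : (0 : ℝ) < (k : ℝ) + 1 := by positivity
  refine ⟨?_, fun hk => ?_⟩
  · rcases le_or_gt (r ^ α) ((k : ℝ) + 1) with hk | hk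
    -- The factor `k + 1` cancels in the product of the two terms, so the bound is uniform in `k`.
    · have hAG : Z ≤ q / 2 * Real.log r * (k + 1) + D * r / (k + 1) := by
        refine le_add_of_sq_le_four_mul (by positivity) (by positivity) (le_of_eq ?_)
        rw [hZsq]
        field_simp
        ring
      calc _ ≤ Real.exp (1 - q / 2 * Real.log r * (k + 1)) * Real.exp (-(D * r / (k + 1))) := by
            gcongr
            exact hfac k hk
        _ ≤ Real.exp (c + 1) * Real.exp (-Z) := by
            rw [← Real.exp_add, ← Real.exp_add]
            exact Real.exp_le_exp.mpr (by linarith)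
    · have hZle : Z ≤ D * r / (k + 1) := by
        have hZ' : Z ≤ D * r ^ (1 - α) := by
          refine le_of_sq_le_sq ?_ (by positivity)
          calc Z ^ 2 = 2 * D * q * r * Real.log r := by rw [hZsq]; ring
            _ ≤ 2 * D * q * r * (D / (2 * q) * r ^ (1 - 2 * α)) := by gcongr
            _ = D ^ 2 * (r ^ (1 : ℝ) * r ^ (1 - 2 * α)) := by
              rw [Real.rpow_one]
              field_simp
            _ = (D * r ^ (1 - α)) ^ 2 := by
              rw [mul_pow, ← Real.rpow_add hr0, sq (r ^ (1 - α)), ← Real.rpow_add hr0]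
              ring_nf
        refine hZ'.trans ?_
        rw [le_div_iff₀ hk1]
        calc D * r ^ (1 - α) * (k + 1) ≤ D * r ^ (1 - α) * r ^ α := by gcongr
          _ = D * r := by
            rw [mul_assoc, ← Real.rpow_add hr0, sub_add_cancel, Real.rpow_one]
      calc _ ≤ Real.exp (c + 1) * Real.exp (-(D * r / (k + 1))) := by
            gcongr
            exact (Real.pow_div_factorial_le_exp c hc.le k).trans
              (Real.exp_le_exp.mpr (by linarith))
        _ ≤ _ := by gcongr
  · have hrα : r ^ α ≤ (k : ℝ) + 1 := by
      refine le_trans ?_ hk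
      rw [Real.sqrt_eq_rpow]
      exact Real.rpow_le_rpow_of_exponent_le hr.le hα2.le
    have hZ' : Z ≤ q / 2 * Real.log r * √r := by
      refine le_of_sq_le_sq ?_ (by positivity)
      rw [mul_pow, Real.sq_sqrt hr0.le, hZsq]
      rw [div_le_iff₀ hq] at h8
      have : 0 ≤ q * r * Real.log r * (Real.log r * q - 8 * D) := by
        have := sub_nonneg.mpr h8
        positivity
      nlinarith
    have hZle : Z ≤ q / 2 * Real.log r * (k + 1) := hZ'.trans (by gcongr)
    rw [← Real.exp_add]
    exact (hfac k hrα).trans (Real.exp_le_exp.mpr (by linarith))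

/-! ### Assembling the asymptotic bound -/

theorem tsum_geometric_ofReal (B : ℝ) (hB : 0 ≤ B) :
    ∑' k : ℕ, ENNReal.ofReal ((1 / 2) ^ k * B) = ENNReal.ofReal (2 * B) := by
  rw [← ENNReal.ofReal_tsum_of_nonneg (fun k => by positivity)
    (summable_geometric_two.mul_right B), tsum_mul_right, tsum_geometric_two]

/-- The quantization error is eventually at most a constant times
`exp (-q √(2 / (s (1 + γ)) r log r))`, for each `q < 1`. -/
theorem eventually_quantError_le {E Ω : Type*} [Nonempty E] [MeasurableSpace E]
    [MeasurableSpace Ω] (P : Measure Ω) {ρ : E → E → ℝ≥0} {w : ℝ≥0} (hw : ∀ x y, ρ x y ≤ w)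
    {γ : ℝ} (hγ0 : 0 ≤ γ) (hγ : upperBoxDim ρ = (γ : EReal)) (X : Ω → JumpPath E)
    {lam K : ℝ} (hlam : 0 < lam) (hK : 0 ≤ K)
    (hN : ∀ k : ℕ, P {ω | jumpCount (X ω) = k} ≤
      ENNReal.ofReal (lam ^ k / (k.factorial : ℝ) * Real.exp (-lam) * K))
    {s : ℝ} (hs : 0 < s) {q : ℝ} (hq : 0 < q) (hq1 : q < 1) :
    ∃ B : ℝ, 0 ≤ B ∧ ∀ᶠ r : ℝ in atTop, quantError P X (pathDistortion ρ) s r ≤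
      ENNReal.ofReal (B * Real.exp (-(q * √(2 / (s * (1 + γ)) * (r * Real.log r))))) := by
  set B₀ : ℝ := (1 + w : ℝ) ^ s * K * Real.exp (2 * lam + 1) with hB₀
  have hB₀0 : 0 ≤ B₀ := by positivity
  refine ⟨(2 * B₀) ^ (1 / s), by positivity, ?_⟩
  -- Taking `c = 2 * lam` instead of `lam` leaves a factor `(1 / 2) ^ k`, which makes the uniform
  -- bound summable over `k`.
  filter_upwards [eventually_exists_codebook hw hγ0 hγ hq hq1,
    eventually_weighted_error_le (c := 2 * lam) (D := s * (q / (1 + γ))) hq hq1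
      (by positivity) (by positivity)] with r hC hr
  obtain ⟨C, hCne, hCr, hCd⟩ := hC
  set G := √(2 / (s * (1 + γ)) * (r * Real.log r)) with hG
  have hsqG : √(2 * (s * (q / (1 + γ))) * q * (r * Real.log r)) = s * q * G := by
    rw [hG, ← Real.sqrt_sq (show 0 ≤ s * q by positivity), ← Real.sqrt_mul (by positivity)]
    congr 1
    field_simp
  rw [hsqG] at hr
  let e : ℕ → ℝ := fun k => if k ≤ ⌊√r⌋₊ then
    (1 + w) * Real.exp (-(q * r / (1 + γ) / (k + 1))) else w
  have he0 : ∀ k, 0 ≤ e k := fun k => by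
    simp only [e]
    split_ifs <;> positivity
  have hterm : ∀ k : ℕ, e k ^ s * (lam ^ k / (k.factorial : ℝ) * Real.exp (-lam) * K) ≤
      (1 / 2) ^ k * (B₀ * Real.exp (-(s * q * G))) := by
    intro k
    have hmain : e k ^ s * ((2 * lam) ^ k / (k.factorial : ℝ)) ≤
        (1 + w : ℝ) ^ s * (Real.exp (2 * lam + 1) * Real.exp (-(s * q * G))) := by
      simp only [e]
      split_ifs with hk
      · rw [Real.mul_rpow (by positivity) (by positivity), ← Real.exp_mul, mul_assoc]
        refine mul_le_mul_of_nonneg_left ?_ (by positivity)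
        have harg : -(q * r / (1 + γ) / ((k : ℝ) + 1)) * s =
            -(s * (q / (1 + γ)) * r / (k + 1)) := by ring
        rw [mul_comm, harg]
        exact (hr k).1
      · have : √r ≤ (k : ℝ) + 1 := by
          have := (Nat.floor_lt (Real.sqrt_nonneg r)).mp (not_le.mp hk)
          linarith
        refine mul_le_mul ?_ ((hr k).2 this) (by positivity) (by positivity)
        exact Real.rpow_le_rpow w.coe_nonneg (by linarith) hs.le
    have hexp : Real.exp (-lam) ≤ 1 := Real.exp_le_one_iff.mpr (by linarith)
    calc e k ^ s * (lam ^ k / (k.factorial : ℝ) * Real.exp (-lam) * K)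
        ≤ e k ^ s * (lam ^ k / (k.factorial : ℝ) * 1 * K) := by
          have := he0 k
          gcongr
      _ = (1 / 2) ^ k * (K * (e k ^ s * ((2 * lam) ^ k / (k.factorial : ℝ)))) := by
          rw [mul_pow, div_pow, one_pow]
          field_simp
      _ ≤ (1 / 2) ^ k * (K * ((1 + w : ℝ) ^ s *
            (Real.exp (2 * lam + 1) * Real.exp (-(s * q * G))))) := by gcongr
      _ = _ := by rw [hB₀]; ring
  calc quantError P X (pathDistortion ρ) s r
      ≤ (∑' k, ENNReal.ofReal (e k) ^ s * P {ω | jumpCount (X ω) = k}) ^ (1 / s) := by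
        refine quantError_le P X _ hs hCne hCr jumpCount (fun k => ENNReal.ofReal (e k))
          fun f => ?_
        obtain ⟨a, ha, hle⟩ := hCd f
        refine ⟨a, ha, hle.trans_eq ?_⟩
        simp only [e]
        split_ifs <;> simp
    _ ≤ (∑' k : ℕ, ENNReal.ofReal ((1 / 2) ^ k * (B₀ * Real.exp (-(s * q * G))))) ^ (1 / s) := by
        refine ENNReal.rpow_le_rpow (ENNReal.tsum_le_tsum fun k => ?_) (by positivity)
        refine (mul_le_mul_right (hN k) _).trans ?_
        rw [ENNReal.ofReal_rpow_of_nonneg (he0 k) hs.le,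
          ← ENNReal.ofReal_mul (Real.rpow_nonneg (he0 k) s)]
        exact ENNReal.ofReal_le_ofReal (hterm k)
    _ = ENNReal.ofReal ((2 * B₀) ^ (1 / s) * Real.exp (-(q * G))) := by
        rw [tsum_geometric_ofReal _ (by positivity),
          ENNReal.ofReal_rpow_of_nonneg (by positivity) (by positivity), ← mul_assoc,
          Real.mul_rpow (by positivity) (by positivity), ← Real.exp_mul]
        congr 3
        field_simp

theorem tendsto_sqrt_mul_log_atTop {c : ℝ} (hc : 0 < c) :
    Tendsto (fun r : ℝ => √(c * (r * Real.log r))) atTop atTop :=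
  Real.tendsto_sqrt_atTop.comp
    ((tendsto_id.atTop_mul_atTop₀ Real.tendsto_log_atTop).const_mul_atTop hc)

/-- Since `g` tends to infinity, lowering `q` to `b < q` absorbs the constant: eventually `B ≤ exp B
≤ exp ((q - b) * g r)`. -/
theorem asympGE_neg_log {D : ℝ → ℝ≥0∞} {g : ℝ → ℝ} (hg : Tendsto g atTop atTop)
    (h : ∀ q : ℝ, 0 < q → q < 1 → ∃ B : ℝ, 0 ≤ B ∧
      ∀ᶠ r : ℝ in atTop, D r ≤ ENNReal.ofReal (B * Real.exp (-(q * g r)))) :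
    AsympGE (fun r => -ENNReal.log (D r)) g := by
  refine (le_liminf_iff (by isBoundedDefault) (by isBoundedDefault)).mpr fun y hy => ?_
  obtain ⟨b, hyb, hb1⟩ := EReal.lt_iff_exists_real_btwn.mp hy
  have hb1 : b < 1 := by exact_mod_cast hb1
  obtain ⟨q, hbq, hq1⟩ := exists_between (max_lt hb1 zero_lt_one)
  obtain ⟨B, hB, hD⟩ := h q ((le_max_right _ _).trans_lt hbq) hq1
  have hqb : 0 < q - b := sub_pos.mpr ((le_max_left _ _).trans_lt hbq)
  filter_upwards [hD, hg.eventually_gt_atTop 0,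
    hg.eventually_ge_atTop (B / (q - b))] with r hD hg0 hgB
  refine hyb.trans_le ?_
  rw [EReal.le_div_iff_mul_le (by exact_mod_cast hg0) (EReal.coe_ne_top _), EReal.le_neg,
    ← EReal.coe_mul, ← EReal.coe_neg, ← EReal.log_exp ((-(b * g r) : ℝ) : EReal), ENNReal.log_le_log_iff,
    EReal.exp_coe]
  refine hD.trans (ENNReal.ofReal_le_ofReal ?_)
  rw [div_le_iff₀ hqb] at hgB
  calc B * Real.exp (-(q * g r)) ≤ Real.exp B * Real.exp (-(q * g r)) := by
        gcongr
        linarith [Real.add_one_le_exp B]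
    _ = Real.exp (B - q * g r) := by rw [← Real.exp_add]; ring_nf
    _ ≤ Real.exp (-(b * g r)) := Real.exp_le_exp.mpr (by linarith)

end JumpCoding

theorem mainTheorem2 {E Ω : Type*} [MeasurableSpace E] [MeasurableSpace Ω]
    (P : Measure Ω) [IsProbabilityMeasure P]
    (ρ : E → E → ℝ≥0) (hρ : JumpCoding.IsDistortion ρ)
    (hw : ∃ w : ℝ≥0, ∀ x y, ρ x y ≤ w)
    (γ : ℝ) (hγ : JumpCoding.upperBoxDim ρ = (γ : EReal))
    (X : Ω → JumpCoding.JumpPath E) (hX : Measurable X)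
    (lam K : ℝ) (hlam : 0 < lam) (hK : 1 ≤ K)
    (hN : ∀ k : ℕ, P {ω | JumpCoding.jumpCount (X ω) = k} ≤
      ENNReal.ofReal (lam ^ k / (k.factorial : ℝ) * Real.exp (-lam) * K))
    (s : ℝ) (hs : 0 < s) :
    JumpCoding.AsympGE
      (fun r => -ENNReal.log
        (JumpCoding.quantError P X (JumpCoding.pathDistortion ρ) s r))
      (fun r => Real.sqrt (2 / (s * (1 + γ)) * (r * Real.log r))) := by
  obtain ⟨w, hw⟩ := hw
  obtain ⟨ω⟩ := nonempty_of_isProbabilityMeasure P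
  have hE : Nonempty E := ⟨X ω ⟨0, by simp⟩⟩
  have hγ0 : 0 ≤ γ := by
    have := JumpCoding.upperBoxDim_nonneg ρ
    rw [hγ] at this
    exact_mod_cast this
  exact JumpCoding.asympGE_neg_log (JumpCoding.tendsto_sqrt_mul_log_atTop (by positivity))
    fun q hq hq1 => JumpCoding.eventually_quantError_le P hw hγ0 hγ X hlam (by linarith) hN hs
      hq hq1
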